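/- In Euclidean space $\mathbb{E}^3$ let $$A=(-1,0,4),\quad B=(1,0,4),\quad C=(0,0,0),\quad D=(0,0,4),\quad E=\left(0,\tfrac{3\sqrt7}{8},\tfrac18\right),$$ and let $X=\Delta(A,B,C)\cup\Delta(C,D,E)$ be the union of the two flat (solid) triangles with these vertices, equipped with its induced length metric $d$: $d(x,y)$ is the infimum of the lengths of the paths in $X$ joining $x$ and $y$. Then: 1. For all $x,y\in X$ the distance $d(x,y)$ is finite and is the length of a shortest path in $X$ from $x$ to $y$. 2. $X$ is a CAT(0) space: any two points are joined by a metric segment (the image of an isometric embedding of $[0,d(x,y)]$ with endpoints $x$ and $y$), and for every geodesic triangle in $X$, the distance between any two points of the triangle is at most the distance between the corresponding points of a comparison triangle in the Euclidean plane. 3. $X$ fails the N-property, i.e. the following is false: whenever $K\subset X$ is closed and convex (contains every metric segment joining two of its points) and $x_1,x_2\in X$ have the same metric projection $P_K(x_1)=P_K(x_2)=p$, then $P_K(\alpha x_1+(1-\alpha)x_2)=p$ for every $\alpha\in(0,1)$. Here $P_K(x)$ denotes the point of $K$ nearest to $x$, and $\alpha x+(1-\alpha)y$ the point of the metric segment $[x,y]$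 at distance $(1-\alpha)d(x,y)$ from $x$. 4. More precisely, the point $D$ is the unique midpoint $\frac12A+\frac12B$ of $A$ and $B$ in $X$, there is a unique metric segment $[C,E]$ in $X$, the projections of $A$, $B$, $D$ onto it exist and are unique, and $$P_{[C,E]}\left(\tfrac12A+\tfrac12B\right)=P_{[C,E]}(D)=F:=\left(0,\tfrac{3\sqrt7}{16},\tfrac1{16}\right),\qquad P_{[C,E]}(A)=P_{[C,E]}(B)\neq F,$$ so that $P_{[C,E]}\left(\frac12A+\frac12B\right)\notin\left[P_{[C,E]}(A),P_{[C,E]}(B)\right]$. -/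

import Mathlib

open scoped ENNReal unitInterval

/-! ### The induced length metric on a subset of a metric space -/

/-- The length of a path `γ` in a subset `S` of a metric space `E`: the supremum of
`∑ edist (γ tᵢ) (γ tᵢ₊₁)` over all subdivisions of the unit interval. -/
noncomputable def pathLength {E : Type*} [PseudoEMetricSpace E] {S : Set E} {x y : S}
    (γ : Path x y) : ℝ≥0∞ :=
  eVariationOn (fun t : I => (γ t : E)) Set.univ

/-- A copy of the set `S`, which will carry the induced length metric (and its topology) instead of
the metric restricted from `E`. -/
@[ext]
structure InducedLength {E : Type*} (S : Set E) where
  pt : S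

section lengthLemmas

theorem pathLength_refl {E : Type*} [PseudoEMetricSpace E] {S : Set E} (x : S) :
    pathLength (Path.refl x) = 0 := by
  unfold pathLength
  apply eVariationOn.constant_on
  rintro _ ⟨a, -, rfl⟩ _ ⟨b, -, rfl⟩
  rfl

theorem pathLength_symm_le {E : Type*} [PseudoEMetricSpace E] {S : Set E} {x y : S}
    (γ : Path x y) : pathLength γ.symm ≤ pathLength γ := by
  unfold pathLength
  have h := eVariationOn.comp_le_of_antitoneOn (fun t : I => (γ t : E)) (s := Set.univ)
    (t := Set.univ) (fun t : I => unitInterval.symm t)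
    (fun a _ b _ hab => by
      change (1 - (b : ℝ)) ≤ 1 - (a : ℝ)
      have : (a : ℝ) ≤ b := hab
      linarith) (fun _ _ => Set.mem_univ _)
  exact h

theorem pathLength_trans_le {E : Type*} [PseudoEMetricSpace E] {S : Set E} {x y z : S}
    (γ : Path x y) (γ' : Path y z) :
    pathLength (γ.trans γ') ≤ pathLength γ + pathLength γ' := by
  unfold pathLength
  set m : I := ⟨1 / 2, by constructor <;> norm_num⟩ with hm
  have hu : (Set.univ : Set I) = Set.Iic m ∪ Set.Ici m := Set.Iic_union_Ici.symm
  rw [hu, eVariationOn.union _ (isGreatest_Iic (a := m)) (isLeast_Ici (a := m)), ← hu]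
  apply add_le_add
  · have h := eVariationOn.comp_le_of_monotoneOn (fun t : I => (γ t : E)) (s := Set.univ)
      (t := Set.Iic m) (fun t : I => Set.projIcc (0 : ℝ) 1 zero_le_one (2 * (t : ℝ)))
      (fun a _ b _ hab => Set.monotone_projIcc _ (by
        have : (a : ℝ) ≤ b := hab
        linarith)) (fun _ _ => Set.mem_univ _)
    refine le_trans (le_of_eq (eVariationOn.congr ?_)) h
    intro t ht
    have ht' : (t : ℝ) ≤ 1 / 2 := ht
    simp only [Path.trans_apply, dif_pos ht', Function.comp]
    rw [Set.projIcc_of_mem zero_le_one ⟨by linarith [t.2.1], by linarith⟩]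
  · have h := eVariationOn.comp_le_of_monotoneOn (fun t : I => (γ' t : E)) (s := Set.univ)
      (t := Set.Ici m) (fun t : I => Set.projIcc (0 : ℝ) 1 zero_le_one (2 * (t : ℝ) - 1))
      (fun a _ b _ hab => Set.monotone_projIcc _ (by
        have : (a : ℝ) ≤ b := hab
        linarith)) (fun _ _ => Set.mem_univ _)
    refine le_trans (le_of_eq (eVariationOn.congr ?_)) h
    intro t ht
    have ht' : 1 / 2 ≤ (t : ℝ) := ht
    simp only [Function.comp]
    rw [Set.projIcc_of_mem zero_le_one ⟨by linarith, by linarith [t.2.2]⟩]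
    by_cases h2 : (t : ℝ) ≤ 1 / 2
    · have h3 : (t : ℝ) = 1 / 2 := le_antisymm h2 ht'
      simp only [Path.trans_apply, dif_pos h2]
      have e1 : (⟨2 * (t : ℝ), by rw [h3]; constructor <;> norm_num⟩ : I) = 1 :=
        Subtype.ext (by simp [h3])
      have e2 : (⟨2 * (t : ℝ) - 1, by rw [h3]; constructor <;> norm_num⟩ : I) = 0 :=
        Subtype.ext (by simp [h3])
      rw [e1, e2, γ.target, γ'.source]
    · simp only [Path.trans_apply, dif_neg h2]

theorem edist_le_pathLength {E : Type*} [PseudoEMetricSpace E] {S : Set E} {x y : S}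
    (γ : Path x y) : edist (x : E) (y : E) ≤ pathLength γ := by
  have h := eVariationOn.edist_le (fun t : I => (γ t : E)) (Set.mem_univ 0) (Set.mem_univ 1)
  simp only [γ.source, γ.target] at h
  exact h

end lengthLemmas

/-- The induced length metric on `S`: the distance between two points is the infimum of the lengths
of the paths in `S` that join them (`∞` when there is none of finite length). -/
noncomputable instance {E : Type*} [EMetricSpace E] (S : Set E) :
    EMetricSpace (InducedLength S) where
  edist x y := ⨅ γ : Path x.pt y.pt, pathLength γ
  edist_self x := le_antisymm
    ((iInf_le _ (Path.refl x.pt)).trans (pathLength_refl x.pt).le) zero_le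
  edist_comm x y := le_antisymm
    (le_iInf fun γ => (iInf_le _ γ.symm).trans (pathLength_symm_le γ))
    (le_iInf fun γ => (iInf_le _ γ.symm).trans (pathLength_symm_le γ))
  edist_triangle x y z := ENNReal.le_iInf_add_iInf fun γ γ' =>
    (iInf_le _ (γ.trans γ')).trans (pathLength_trans_le γ γ')
  eq_of_edist_eq_zero {x y} h := InducedLength.ext (Subtype.ext (edist_le_zero.1
    ((le_iInf fun γ => edist_le_pathLength γ).trans h.le)))

theorem InducedLength.edist_def {E : Type*} [EMetricSpace E] {S : Set E} (x y : InducedLength S) :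
    edist x y = ⨅ γ : Path x.pt y.pt, pathLength γ := rfl

/-! ### Geodesics, CAT(0) spaces, projections, property N -/

/-- `s` is a metric segment joining `x` and `y`: the image of an isometric embedding
`φ : [0, dist x y] → X` with `φ 0 = x` and `φ (dist x y) = y`. -/
def IsMetricSegment {X : Type*} [MetricSpace X] (x y : X) (s : Set X) : Prop :=
  ∃ φ : ℝ → X, φ 0 = x ∧ φ (dist x y) = y ∧
    (∀ a ∈ Set.Icc 0 (dist x y), ∀ b ∈ Set.Icc 0 (dist x y), dist (φ a) (φ b) = |a - b|) ∧
    s = φ '' Set.Icc 0 (dist x y)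

/-- Any two points are joined by a metric segment. -/
def IsGeodesicSpace (X : Type*) [MetricSpace X] : Prop :=
  ∀ x y : X, ∃ s, IsMetricSegment x y s

/-- A geodesic space in which every geodesic triangle satisfies the CAT(0) inequality. The triangle
has vertices `x₁ x₂ x₃` and edges `s₁₂ s₁₃ s₂₃`, the comparison triangle in the Euclidean plane has
vertices `u₁ u₂ u₃`, and `v₁ v₂` are the comparison points of `y₁ y₂`. The numbering of the vertices
is arbitrary, so that `y₁ y₂` may lie on any two edges. -/
def IsCAT0 (X : Type*) [MetricSpace X] : Prop :=
  IsGeodesicSpace X ∧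
    ∀ (x₁ x₂ x₃ : X) (s₁₂ s₁₃ s₂₃ : Set X),
      IsMetricSegment x₁ x₂ s₁₂ → IsMetricSegment x₁ x₃ s₁₃ → IsMetricSegment x₂ x₃ s₂₃ →
    ∀ u₁ u₂ u₃ : EuclideanSpace ℝ (Fin 2),
      dist u₁ u₂ = dist x₁ x₂ → dist u₁ u₃ = dist x₁ x₃ → dist u₂ u₃ = dist x₂ x₃ →
    ∀ y₁ ∈ s₁₂, ∀ y₂ ∈ s₁₃, ∀ v₁ ∈ segment ℝ u₁ u₂, ∀ v₂ ∈ segment ℝ u₁ u₃,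
      dist u₁ v₁ = dist x₁ y₁ → dist u₁ v₂ = dist x₁ y₂ →
      dist y₁ y₂ ≤ dist v₁ v₂

/-- `z` is a point `α x + (1 - α) y`. -/
def IsGeodesicCombo {X : Type*} [MetricSpace X] (α : ℝ) (x y z : X) : Prop :=
  ∃ s, IsMetricSegment x y s ∧ z ∈ s ∧
    dist x z = (1 - α) * dist x y ∧ dist z y = α * dist x y

/-- The metric projection `P_C(x)`, as the set of points of `C` nearest to `x`. -/
def metricProj {X : Type*} [MetricSpace X] (C : Set X) (x : X) : Set X :=
  {y | y ∈ C ∧ dist x y = Metric.infDist x C}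

/-- `C` contains every metric segment that joins two of its points. -/
def IsGeodesicallyConvex {X : Type*} [MetricSpace X] (C : Set X) : Prop :=
  ∀ x ∈ C, ∀ y ∈ C, ∀ s, IsMetricSegment x y s → s ⊆ C

/-- Property N of a CAT(0) space: if two points have the same projection `p` onto a closed convex
set, then so have all points between them. -/
def HasPropertyN (X : Type*) [MetricSpace X] : Prop :=
  ∀ C : Set X, IsClosed C → IsGeodesicallyConvex C →
    ∀ x₁ x₂ p : X, metricProj C x₁ = {p} → metricProj C x₂ = {p} →
      ∀ α ∈ Set.Ioo (0 : ℝ) 1, ∀ z : X, IsGeodesicCombo α x₁ x₂ z → metricProj C z = {p}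

/-! ### The union of two triangles -/

namespace TwoTriangles

/-- Euclidean 3-space. -/
abbrev E3 : Type := EuclideanSpace ℝ (Fin 3)

noncomputable def ptA : E3 := !₂[-1, 0, 4]
noncomputable def ptB : E3 := !₂[1, 0, 4]
noncomputable def ptC : E3 := !₂[0, 0, 0]
noncomputable def ptD : E3 := !₂[0, 0, 4]
noncomputable def ptE : E3 := !₂[0, 3 * √7 / 8, 1 / 8]

/-- The union of the (solid, flat) triangles `ABC` and `CDE`. -/
def carrier : Set E3 := convexHull ℝ {ptA, ptB, ptC} ∪ convexHull ℝ {ptC, ptD, ptE}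

/-- The union of the two triangles with its induced length metric. -/
abbrev Space : Type := InducedLength carrier

noncomputable def A : Space := ⟨ptA, Or.inl (subset_convexHull ℝ _ (by simp))⟩
noncomputable def B : Space := ⟨ptB, Or.inl (subset_convexHull ℝ _ (by simp))⟩
noncomputable def C : Space := ⟨ptC, Or.inl (subset_convexHull ℝ _ (by simp))⟩
noncomputable def D : Space := ⟨ptD, Or.inr (subset_convexHull ℝ _ (by simp))⟩
noncomputable def E : Space := ⟨ptE, Or.inr (subset_convexHull ℝ _ (by simp))⟩

/-- The point `(0, 3√7/16, 1/16)`, the midpoint of `C` and `E`. -/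
noncomputable def F : Space :=
  ⟨!₂[0, 3 * √7 / 16, 1 / 16], Or.inr (by
    have h := (convex_convexHull ℝ ({ptC, ptD, ptE} : Set E3)).midpoint_mem
      (subset_convexHull ℝ _ (by simp : ptC ∈ _)) (subset_convexHull ℝ _ (by simp : ptE ∈ _))
    convert h using 1
    ext i
    fin_cases i <;> simp [midpoint_eq_smul_add, ptC, ptE] <;> ring)⟩

theorem exists_path_to_C (x : Space) : ∃ γ : Path x.pt C.pt, pathLength γ ≠ ⊤ := by
  obtain ⟨⟨x, hx⟩⟩ := x
  have hseg : ∀ t : I, AffineMap.lineMap x ptC (t : ℝ) ∈ carrier := by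
    intro t
    have key : ∀ s : Set E3, ptC ∈ s → x ∈ convexHull ℝ s →
        AffineMap.lineMap x ptC (t : ℝ) ∈ convexHull ℝ s := fun s hs hxs =>
      (convex_convexHull ℝ s).lineMap_mem hxs (subset_convexHull ℝ s hs) t.2
    rcases hx with h | h
    · exact Or.inl (key _ (by simp) h)
    · exact Or.inr (key _ (by simp) h)
  refine ⟨⟨⟨fun t => ⟨AffineMap.lineMap x ptC (t : ℝ), hseg t⟩, ?_⟩, ?_, ?_⟩, ?_⟩
  · exact Continuous.subtype_mk
      (AffineMap.lineMap_continuous.comp continuous_subtype_val) _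
  · simp
  · simp [C]
  · have hL : LipschitzWith (nndist x ptC) (AffineMap.lineMap x ptC : ℝ → E3) :=
      lipschitzWith_lineMap x ptC
    have h1 : eVariationOn ((AffineMap.lineMap x ptC : ℝ → E3) ∘ fun t : I => (t : ℝ)) Set.univ
        ≤ (nndist x ptC : ℝ≥0∞) * eVariationOn (fun t : I => (t : ℝ)) Set.univ :=
      (hL.lipschitzOnWith (s := Set.univ)).comp_eVariationOn_le (fun _ _ => Set.mem_univ _)
    have h2 : eVariationOn (fun t : I => (t : ℝ)) Set.univ ≠ ⊤ := by
      have h3 := (show MonotoneOn (fun t : I => (t : ℝ)) Set.univ from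
        fun a _ b _ hab => hab).eVariationOn_eq (Set.mem_univ (0 : I)) (Set.mem_univ (1 : I))
      have h4 : (Set.univ : Set I) ∩ Set.Icc 0 1 = Set.univ :=
        Set.eq_univ_of_forall fun t => ⟨Set.mem_univ t, unitInterval.nonneg', unitInterval.le_one'⟩
      rw [h4] at h3
      exact ne_of_eq_of_ne h3 ENNReal.ofReal_ne_top
    exact ne_top_of_le_ne_top (ENNReal.mul_ne_top ENNReal.coe_ne_top h2) h1

theorem edist_ne_top (x y : Space) : edist x y ≠ ⊤ := by
  have h : ∀ z : Space, edist z C ≠ ⊤ := fun z => by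
    obtain ⟨γ, hγ⟩ := exists_path_to_C z
    exact ne_top_of_le_ne_top hγ (iInf_le _ γ)
  exact ne_top_of_le_ne_top (ENNReal.add_ne_top.2 ⟨h x, h y⟩) (edist_triangle_right x y C)

noncomputable instance : MetricSpace Space := EMetricSpace.toMetricSpace edist_ne_top

end TwoTriangles

/-!
Cut the triangle `ABC` along `CD`. The space is then a book of three flat pages `ACD`, `BCD`, `CDE`
with the common edge `CD`, and any two of the pages unfold to a convex figure of the plane. A point
of a page is determined by its height and by its distance to the axis through `C` and `D`, so the
space is a convex subset of the product of a tripod and a line. In the coordinates of `ℝ³` the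
distance of the tripod is the `ℓ¹` distance of the first two coordinates, which gives the closed
formula `dist_eq` for the length metric. The upper bound in that formula is a straight or once
broken line, the lower bound holds because a path between two pages has to cross the axis.

The CAT(0) inequality is deduced from `HasCNPoints`: for `x`, `y` and `t ∈ [0, 1]` there is a point
`m` with `d(p, m)² ≤ (1 - t) d(p, x)² + t d(p, y)² - t (1 - t) d(x, y)²` for all `p`. This
inequality also yields existence and uniqueness of metric segments and their convexity. It can be
checked separately in the two factors of the product: in the line it is an identity, and in the
tripod it is an identity if `p` lies on a line through the legs of `x` and `y`, and a consequence
of the triangle inequality if `p` lies on another leg (`leg_sq_le`).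

For the projections, the triangle `CDE` is isosceles with apex `D`, so that `D` projects to the
midpoint `F` of `[C, E]`; but the angles `ACE` and `BCE` are obtuse in the unfolded pages, so that
`A` and `B` both project to `C`. Since `D` is the midpoint of `A` and `B`, the N-property fails.
-/

/-! ### Barycentres in metric spaces and the CAT(0) inequality -/

/-- For all `x`, `y` and `t ∈ [0, 1]` there is a point `m` at which the Euclidean formula for the
squared distance to the point `(1 - t) x + t y` holds as an inequality, for distances to every
point `p` of the space. -/
def HasCNPoints (X : Type*) [MetricSpace X] : Prop :=
  ∀ x y : X, ∀ t ∈ Set.Icc (0 : ℝ) 1, ∃ m : X, ∀ p : X,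
    dist p m ^ 2 ≤ (1 - t) * dist p x ^ 2 + t * dist p y ^ 2 - t * (1 - t) * dist x y ^ 2

section CN

variable {X : Type*} [MetricSpace X]

/-- A point `z` with the right distances to `x` and `y` coincides with the point given by
`HasCNPoints`: insert `p = z` in the inequality. -/
theorem HasCNPoints.dist_sq_le (h : HasCNPoints X) {x y z : X} {t : ℝ} (ht : t ∈ Set.Icc (0 : ℝ) 1)
    (hx : dist x z = t * dist x y) (hy : dist z y = (1 - t) * dist x y) (p : X) :
    dist p z ^ 2 ≤ (1 - t) * dist p x ^ 2 + t * dist p y ^ 2 - t * (1 - t) * dist x y ^ 2 := by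
  obtain ⟨m, hm⟩ := h x y t ht
  have h0 := hm z
  rw [dist_comm z x, hx, hy] at h0
  have h1 : dist z m = 0 := by
    have : dist z m ^ 2 ≤ 0 := h0.trans (le_of_eq (by ring))
    exact pow_eq_zero_iff two_ne_zero |>.1 (le_antisymm this (sq_nonneg _))
  rw [dist_eq_zero.1 h1]
  exact hm p

theorem HasCNPoints.eq_of_dist_eq (h : HasCNPoints X) {x y z z' : X} {t : ℝ}
    (ht : t ∈ Set.Icc (0 : ℝ) 1)
    (hx : dist x z = t * dist x y) (hy : dist z y = (1 - t) * dist x y)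
    (hx' : dist x z' = t * dist x y) (hy' : dist z' y = (1 - t) * dist x y) : z = z' := by
  have h0 := h.dist_sq_le ht hx' hy' z
  rw [dist_comm z x, hx, hy] at h0
  have : dist z z' ^ 2 ≤ 0 := h0.trans (le_of_eq (by ring))
  exact dist_eq_zero.1 (pow_eq_zero_iff two_ne_zero |>.1 (le_antisymm this (sq_nonneg _)))

/-- The distances to both ends determine a point among those on which the triangle inequality is
an equality. -/
theorem HasCNPoints.eq_of_dist_add_dist (h : HasCNPoints X) {x y z z' : X}
    (hz : dist x z + dist z y = dist x y) (hz' : dist x z' + dist z' y = dist x y)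
    (he : dist x z = dist x z') : z = z' := by
  rcases eq_or_ne (dist x y) 0 with h0 | h0
  · have h1 : dist x z = 0 := by
      linarith [dist_nonneg (x := x) (y := z), dist_nonneg (x := z) (y := y)]
    have h2 : dist x z' = 0 := he.symm.trans h1
    rw [← dist_eq_zero.1 h1, ← dist_eq_zero.1 h2]
  · have hp : 0 < dist x y := lt_of_le_of_ne dist_nonneg h0.symm
    have hd : dist x z / dist x y * dist x y = dist x z := div_mul_cancel₀ _ h0
    refine h.eq_of_dist_eq (t := dist x z / dist x y) ⟨by positivity, ?_⟩ hd.symm ?_ ?_ ?_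
    · rw [div_le_one hp]
      linarith [dist_nonneg (x := z) (y := y)]
    · linarith
    · linarith
    · linarith

theorem HasCNPoints.exists_isMetricSegment (h : HasCNPoints X) (x y : X) :
    ∃ s, IsMetricSegment x y s := by
  -- The point at parameter `t` is the one given by `HasCNPoints`; inserting `p = x`, `y`, `m s`
  -- bounds all distances from above, and the triangle inequality turns the bounds into equalities.
  have key : ∀ t : ℝ, ∃ m : X, t ∈ Set.Icc (0 : ℝ) 1 → ∀ p : X,
      dist p m ^ 2 ≤ (1 - t) * dist p x ^ 2 + t * dist p y ^ 2 - t * (1 - t) * dist x y ^ 2 := by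
    intro t
    by_cases ht : t ∈ Set.Icc (0 : ℝ) 1
    · obtain ⟨m, hm⟩ := h x y t ht
      exact ⟨m, fun _ => hm⟩
    · exact ⟨x, fun h' => absurd h' ht⟩
  choose m hm using key
  set d := dist x y with hd
  have hd0 : 0 ≤ d := dist_nonneg
  have hle : ∀ {u : X} {v : ℝ} {t : ℝ}, 0 ≤ v → dist u (m t) ^ 2 ≤ v ^ 2 → dist u (m t) ≤ v :=
    fun hv h => (sq_le_sq₀ dist_nonneg hv).1 h
  have h1 : ∀ t ∈ Set.Icc (0 : ℝ) 1, dist x (m t) ≤ t * d := fun t ht =>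
    hle (mul_nonneg ht.1 hd0) ((hm t ht x).trans (le_of_eq (by rw [dist_self, ← hd]; ring)))
  have h2 : ∀ t ∈ Set.Icc (0 : ℝ) 1, dist y (m t) ≤ (1 - t) * d := fun t ht =>
    hle (mul_nonneg (by linarith [ht.2]) hd0)
      ((hm t ht y).trans (le_of_eq (by rw [dist_self, dist_comm y x, ← hd]; ring)))
  have h1' : ∀ t ∈ Set.Icc (0 : ℝ) 1, dist x (m t) = t * d := fun t ht => by
    have := dist_triangle_right x y (m t)
    linarith [h1 t ht, h2 t ht]
  have h2' : ∀ t ∈ Set.Icc (0 : ℝ) 1, dist y (m t) = (1 - t) * d := fun t ht => by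
    have := dist_triangle_right x y (m t)
    linarith [h1 t ht, h2 t ht]
  have h3 : ∀ s ∈ Set.Icc (0 : ℝ) 1, ∀ t ∈ Set.Icc (0 : ℝ) 1,
      dist (m s) (m t) = |s - t| * d := by
    intro s hs t ht
    apply le_antisymm
    · apply hle (by positivity)
      refine (hm t ht (m s)).trans (le_of_eq ?_)
      rw [dist_comm _ x, dist_comm _ y, h1' s hs, h2' s hs, mul_pow |s - t|, sq_abs]
      ring
    · have h4 := dist_triangle x (m s) (m t)
      have h5 := dist_triangle_right x (m s) (m t)
      rw [h1' s hs, h1' t ht] at h4 h5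
      rcases abs_cases (s - t) with ⟨h6, -⟩ | ⟨h6, -⟩ <;> rw [h6] <;> linarith
  have hmem : ∀ a ∈ Set.Icc 0 d, a / d ∈ Set.Icc (0 : ℝ) 1 := fun a ha =>
    ⟨div_nonneg ha.1 hd0, div_le_one_of_le₀ ha.2 hd0⟩
  rcases eq_or_ne d 0 with h0 | h0
  · have hxy : x = y := dist_eq_zero.1 h0
    refine ⟨_, fun _ => x, rfl, hxy, fun a ha b hb => ?_, rfl⟩
    rw [← hd, h0, Set.Icc_self] at ha hb
    rw [Set.mem_singleton_iff.1 ha, Set.mem_singleton_iff.1 hb]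
    simp
  · refine ⟨_, fun a => m (a / d), ?_, ?_, fun a ha b hb => ?_, rfl⟩
    · change m (0 / d) = x
      rw [zero_div]
      have := h1' 0 ⟨le_rfl, zero_le_one⟩
      rw [zero_mul] at this
      exact (dist_eq_zero.1 this).symm
    · change m (d / d) = y
      rw [div_self h0]
      have := h2' 1 ⟨zero_le_one, le_rfl⟩
      rw [sub_self, zero_mul] at this
      exact (dist_eq_zero.1 this).symm
    · rw [h3 _ (hmem a ha) _ (hmem b hb), ← sub_div, abs_div, abs_of_nonneg hd0,
        div_mul_cancel₀ _ h0]

theorem IsMetricSegment.dist_add_dist {x y z : X} {s : Set X} (hs : IsMetricSegment x y s)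
    (hz : z ∈ s) : dist x z + dist z y = dist x y := by
  obtain ⟨φ, h0, h1, hφ, rfl⟩ := hs
  obtain ⟨a, ha, rfl⟩ := hz
  have e1 := hφ 0 ⟨le_rfl, dist_nonneg⟩ a ha
  have e2 := hφ a ha _ ⟨dist_nonneg, le_rfl⟩
  rw [h0, zero_sub, abs_neg, abs_of_nonneg ha.1] at e1
  rw [h1, abs_sub_comm, abs_of_nonneg (sub_nonneg.2 ha.2)] at e2
  rw [e1, e2]
  ring

theorem IsMetricSegment.exists_mem_dist_eq {x y : X} {s : Set X} (hs : IsMetricSegment x y s)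
    {a : ℝ} (ha : a ∈ Set.Icc 0 (dist x y)) : ∃ z ∈ s, dist x z = a := by
  obtain ⟨φ, h0, h1, hφ, rfl⟩ := hs
  refine ⟨φ a, ⟨a, ha, rfl⟩, ?_⟩
  have e1 := hφ 0 ⟨le_rfl, dist_nonneg⟩ a ha
  rwa [h0, zero_sub, abs_neg, abs_of_nonneg ha.1] at e1

theorem IsMetricSegment.isClosed {x y : X} {s : Set X} (hs : IsMetricSegment x y s) :
    IsClosed s := by
  obtain ⟨φ, -, -, hφ, rfl⟩ := hs
  refine (isCompact_Icc.image_of_continuousOn ?_).isClosed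
  have : LipschitzOnWith 1 φ (Set.Icc 0 (dist x y)) := LipschitzOnWith.of_dist_le_mul
    fun a ha b hb => by rw [hφ a ha b hb, Real.dist_eq, NNReal.coe_one, one_mul]
  exact this.continuousOn

/-- The metric segment with given ends is the set of all points between them. -/
theorem HasCNPoints.eq_setOf_dist_add_dist (h : HasCNPoints X) {x y : X} {s : Set X}
    (hs : IsMetricSegment x y s) : s = {z | dist x z + dist z y = dist x y} := by
  ext z
  refine ⟨fun hz => hs.dist_add_dist hz, fun hz => ?_⟩
  obtain ⟨w, hw, he⟩ := hs.exists_mem_dist_eq (a := dist x z)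
    ⟨dist_nonneg, by linarith [hz.symm.le, hz.le, dist_nonneg (x := z) (y := y)]⟩
  rwa [h.eq_of_dist_add_dist hz (hs.dist_add_dist hw) he.symm]

theorem HasCNPoints.isGeodesicallyConvex (h : HasCNPoints X) {x y : X} {s : Set X}
    (hs : IsMetricSegment x y s) : IsGeodesicallyConvex s := by
  have hS := h.eq_setOf_dist_add_dist hs
  intro u hu v hv s' hs' z hz
  have hz' := hs'.dist_add_dist hz
  rw [hS]
  change dist x z + dist z y = dist x y
  -- The ends may come in either order along `s`.
  obtain ⟨φ, h0, h1, hφ, rfl⟩ := hs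
  obtain ⟨a, ha, rfl⟩ := hu
  obtain ⟨b, hb, rfl⟩ := hv
  have hx := fun c hc => hφ 0 ⟨le_rfl, dist_nonneg⟩ c hc
  have hy := fun c hc => hφ c hc _ ⟨dist_nonneg, le_rfl⟩
  rw [h0] at hx
  rw [h1] at hy
  have ea := hx a ha
  have eb := hx b hb
  have fa := hy a ha
  have fb := hy b hb
  rw [zero_sub, abs_neg, abs_of_nonneg ha.1] at ea
  rw [zero_sub, abs_neg, abs_of_nonneg hb.1] at eb
  rw [abs_sub_comm, abs_of_nonneg (sub_nonneg.2 ha.2)] at fa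
  rw [abs_sub_comm, abs_of_nonneg (sub_nonneg.2 hb.2)] at fb
  rw [hφ a ha b hb] at hz'
  apply le_antisymm _ (dist_triangle _ _ _)
  have t1 := dist_triangle x (φ a) z
  have t2 := dist_triangle x (φ b) z
  have t3 := dist_triangle z (φ b) y
  have t4 := dist_triangle z (φ a) y
  rw [dist_comm (φ b) z] at t2
  rw [dist_comm z (φ a)] at t4
  rcases abs_cases (a - b) with ⟨h6, -⟩ | ⟨h6, -⟩ <;> rw [h6] at hz' <;> linarith

theorem IsMetricSegment.exists_dist_eq_mul {x y z : X} {s : Set X} (hs : IsMetricSegment x y s)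
    (hz : z ∈ s) : ∃ t ∈ Set.Icc (0 : ℝ) 1,
      dist x z = t * dist x y ∧ dist z y = (1 - t) * dist x y := by
  have hd := hs.dist_add_dist hz
  have n1 := dist_nonneg (x := x) (y := z)
  have n2 := dist_nonneg (x := z) (y := y)
  rcases eq_or_ne (dist x y) 0 with h0 | h0
  · exact ⟨0, ⟨le_rfl, zero_le_one⟩, by rw [h0] at hd ⊢; linarith,
      by rw [h0] at hd ⊢; linarith⟩
  · have hc : dist x z / dist x y * dist x y = dist x z := div_mul_cancel₀ _ h0
    exact ⟨dist x z / dist x y, ⟨by positivity, div_le_one_of_le₀ (by linarith) dist_nonneg⟩,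
      hc.symm, by linarith⟩

theorem dist_lineMap_sq {V : Type*} [NormedAddCommGroup V] [InnerProductSpace ℝ V] (p x y : V)
    (t : ℝ) : dist p (AffineMap.lineMap x y t) ^ 2
      = (1 - t) * dist p x ^ 2 + t * dist p y ^ 2 - t * (1 - t) * dist x y ^ 2 := by
  have e1 : p - AffineMap.lineMap x y t = (1 - t) • (p - x) + t • (p - y) := by
    rw [AffineMap.lineMap_apply_module]
    module
  have e2 : x - y = (p - y) - (p - x) := by abel
  rw [dist_eq_norm, dist_eq_norm, dist_eq_norm, dist_eq_norm, e1, e2]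
  generalize p - x = a
  generalize p - y = b
  rw [norm_add_sq_real,
    norm_sub_sq_real, norm_smul, norm_smul, mul_pow, mul_pow, Real.norm_eq_abs, Real.norm_eq_abs,
    sq_abs, sq_abs, inner_smul_left, inner_smul_right, real_inner_comm a b]
  simp only [conj_trivial]
  ring

theorem eq_lineMap_of_mem_segment {V : Type*} [NormedAddCommGroup V] [NormedSpace ℝ V]
    {x y v : V} (hv : v ∈ segment ℝ x y) {t : ℝ} (ht : dist x v = t * dist x y) :
    v = AffineMap.lineMap x y t := by
  rw [segment_eq_image_lineMap] at hv
  obtain ⟨t', ht', rfl⟩ := hv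
  rw [dist_left_lineMap, Real.norm_eq_abs, abs_of_nonneg ht'.1] at ht
  rcases eq_or_ne x y with rfl | hxy
  · simp
  · rw [mul_right_cancel₀ (dist_ne_zero.2 hxy) ht]

/-- Applying the inequality on the side `x₁ x₃` and then on the side `x₁ x₂` bounds
`dist y₁ y₂` by the expression which, in the plane, is equal to `dist v₁ v₂`. -/
theorem HasCNPoints.isCAT0 (h : HasCNPoints X) : IsCAT0 X := by
  refine ⟨h.exists_isMetricSegment, ?_⟩
  intro x₁ x₂ x₃ s₁₂ s₁₃ s₂₃ h₁₂ h₁₃ _ u₁ u₂ u₃ e₁₂ e₁₃ e₂₃ y₁ hy₁ y₂ hy₂ v₁ hv₁ v₂ hv₂ d₁ d₂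
  obtain ⟨a, ha, a1, a2⟩ := h₁₂.exists_dist_eq_mul hy₁
  obtain ⟨b, hb, b1, b2⟩ := h₁₃.exists_dist_eq_mul hy₂
  have f1 := eq_lineMap_of_mem_segment hv₁ (t := a) (by rw [d₁, a1, e₁₂])
  have f2 := eq_lineMap_of_mem_segment hv₂ (t := b) (by rw [d₂, b1, e₁₃])
  have g1 := h.dist_sq_le hb b1 b2 y₁
  have g2 := h.dist_sq_le ha a1 a2 x₃
  have k1 := dist_lineMap_sq v₁ u₁ u₃ b
  have k2 := dist_lineMap_sq u₃ u₁ u₂ a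
  rw [← f2] at k1
  rw [← f1] at k2
  rw [dist_comm v₁ u₁, dist_comm v₁ u₃, d₁, e₁₃, k2, dist_comm u₃ u₁, dist_comm u₃ u₂,
    e₁₃, e₁₂, e₂₃] at k1
  rw [dist_comm y₁ x₁] at g1
  rw [dist_comm x₃ y₁, dist_comm x₃ x₁, dist_comm x₃ x₂] at g2
  have g3 := mul_le_mul_of_nonneg_left g2 hb.1
  exact (sq_le_sq₀ dist_nonneg dist_nonneg).1 (by linarith)

theorem metricProj_eq_singleton {K : Set X} {x p : X} (hp : p ∈ K)
    (h : ∀ q ∈ K, q ≠ p → dist x p < dist x q) : metricProj K x = {p} := by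
  have hle : ∀ q ∈ K, dist x p ≤ dist x q := fun q hq => by
    rcases eq_or_ne q p with rfl | hqp
    · exact le_rfl
    · exact (h q hq hqp).le
  have hinf : Metric.infDist x K = dist x p :=
    le_antisymm (Metric.infDist_le_dist_of_mem hp)
      ((Metric.le_infDist ⟨p, hp⟩).2 fun q hq => hle q hq)
  ext q
  rw [Set.mem_singleton_iff]
  constructor
  · rintro ⟨hq, he⟩
    by_contra hqp
    exact absurd (he.trans hinf) (h q hq hqp).ne'
  · rintro rfl
    exact ⟨hp, hinf.symm⟩

end CN

/-! ### Paths of given length -/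

theorem exists_path_of_convex {V : Type*} [NormedAddCommGroup V] [NormedSpace ℝ V] {S K : Set V}
    (hK : Convex ℝ K) (hKS : K ⊆ S) {x y : S} (hx : (x : V) ∈ K) (hy : (y : V) ∈ K) :
    ∃ γ : Path x y, pathLength γ ≤ edist (x : V) y := by
  refine ⟨⟨⟨fun t => ⟨AffineMap.lineMap (x : V) (y : V) (t : ℝ),
    hKS (hK.lineMap_mem hx hy t.2)⟩, ?_⟩, ?_, ?_⟩, ?_⟩
  · exact Continuous.subtype_mk (AffineMap.lineMap_continuous.comp continuous_subtype_val) _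
  · simp
  · simp
  · have hL : LipschitzWith (nndist (x : V) y) (AffineMap.lineMap (x : V) (y : V) : ℝ → V) :=
      lipschitzWith_lineMap _ _
    have h1 : eVariationOn ((AffineMap.lineMap (x : V) (y : V) : ℝ → V) ∘ fun t : I => (t : ℝ))
        Set.univ ≤ (nndist (x : V) y : ℝ≥0∞) * eVariationOn (fun t : I => (t : ℝ)) Set.univ :=
      (hL.lipschitzOnWith (s := Set.univ)).comp_eVariationOn_le (fun _ _ => Set.mem_univ _)
    have h2 : eVariationOn (fun t : I => (t : ℝ)) Set.univ = 1 := by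
      have h3 := (show MonotoneOn (fun t : I => (t : ℝ)) Set.univ from
        fun a _ b _ hab => hab).eVariationOn_eq (Set.mem_univ (0 : I)) (Set.mem_univ (1 : I))
      have h4 : (Set.univ : Set I) ∩ Set.Icc 0 1 = Set.univ :=
        Set.eq_univ_of_forall fun t => ⟨Set.mem_univ t, unitInterval.nonneg', unitInterval.le_one'⟩
      rw [h4] at h3
      simpa using h3
    rw [h2, mul_one, ← edist_nndist] at h1
    exact h1

theorem edist_add_edist_le_pathLength {V : Type*} [PseudoEMetricSpace V] {S : Set V} {x y : S}
    (γ : Path x y) (t : I) : edist (x : V) (γ t) + edist (γ t : V) y ≤ pathLength γ := by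
  unfold pathLength
  rw [← Set.Iic_union_Ici (a := t),
    eVariationOn.union _ (isGreatest_Iic (a := t)) (isLeast_Ici (a := t))]
  have h1 := eVariationOn.edist_le (fun s : I => (γ s : V)) (s := Set.Iic t) (x := 0) (y := t)
    unitInterval.nonneg' (Set.mem_Iic.2 le_rfl)
  have h2 := eVariationOn.edist_le (fun s : I => (γ s : V)) (s := Set.Ici t) (x := t) (y := 1)
    (Set.mem_Ici.2 le_rfl) unitInterval.le_one'
  simp only [γ.source] at h1
  simp only [γ.target] at h2
  exact add_le_add h1 h2

theorem Path.exists_mem_inter {V : Type*} [TopologicalSpace V] {S K L : Set V}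
    (hS : S ⊆ K ∪ L) (hK : IsClosed K) (hL : IsClosed L) {x y : S} (hx : (x : V) ∈ K)
    (hy : (y : V) ∈ L) (γ : Path x y) : ∃ t, (γ t : V) ∈ K ∩ L := by
  have hc : Continuous fun t : I => (γ t : V) := continuous_subtype_val.comp γ.continuous
  obtain ⟨t, -, ht⟩ := isPreconnected_closed_iff.1 (isPreconnected_univ (α := I)) _ _
    (hK.preimage hc) (hL.preimage hc) (fun t _ => hS (γ t).2)
    ⟨0, trivial, by simpa using hx⟩ ⟨1, trivial, by simpa using hy⟩
  exact ⟨t, ht⟩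

namespace TwoTriangles

/-! ### The distance in the book of three pages -/

/-- The triangle `ABC`, which contains the two pages with legs on the first axis. -/
abbrev triABC : Set E3 := convexHull ℝ {ptA, ptB, ptC}
/-- The triangle `CDE`, the page whose leg is on the second axis. -/
abbrev triCDE : Set E3 := convexHull ℝ {ptC, ptD, ptE}

theorem isClosed_triABC : IsClosed triABC :=
  (Set.toFinite _).isClosed_convexHull ℝ

theorem isClosed_triCDE : IsClosed triCDE :=
  (Set.toFinite _).isClosed_convexHull ℝ

theorem coord_of_mem_triABC {x : E3} (hx : x ∈ triABC) : x 1 = 0 ∧ 0 ≤ x 2 ∧ x 2 ≤ 4 := by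
  have hconv : Convex ℝ {x : E3 | x 1 = 0 ∧ 0 ≤ x 2 ∧ x 2 ≤ 4} := by
    rintro x ⟨h1, h2, h3⟩ y ⟨h1', h2', h3'⟩ a b ha hb hab
    refine ⟨by simp [h1, h1'], by simp; positivity, ?_⟩
    simp only [PiLp.add_apply, PiLp.smul_apply, smul_eq_mul]
    nlinarith
  refine convexHull_min ?_ hconv hx
  rintro _ (rfl | rfl | rfl) <;> simp [ptA, ptB, ptC]

theorem coord_of_mem_triCDE {x : E3} (hx : x ∈ triCDE) :
    x 0 = 0 ∧ 0 ≤ x 1 ∧ 0 ≤ x 2 ∧ x 2 ≤ 4 := by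
  have hconv : Convex ℝ {x : E3 | x 0 = 0 ∧ 0 ≤ x 1 ∧ 0 ≤ x 2 ∧ x 2 ≤ 4} := by
    rintro x ⟨h0, h1, h2, h3⟩ y ⟨h0', h1', h2', h3'⟩ a b ha hb hab
    refine ⟨by simp [h0, h0'], by simp; positivity, by simp; positivity, ?_⟩
    simp only [PiLp.add_apply, PiLp.smul_apply, smul_eq_mul]
    nlinarith
  refine convexHull_min ?_ hconv hx
  rintro _ (rfl | rfl | rfl) <;> simp [ptC, ptD, ptE]
  constructor
  · positivity
  · norm_num

theorem axis_mem_triABC {z : ℝ} (h0 : 0 ≤ z) (h4 : z ≤ 4) : (!₂[0, 0, z] : E3) ∈ triABC := by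
  have hconv := convex_convexHull ℝ ({ptA, ptB, ptC} : Set E3)
  have hD : ptD ∈ triABC := by
    have h := hconv.midpoint_mem (subset_convexHull ℝ _ (by simp : ptA ∈ _))
      (subset_convexHull ℝ _ (by simp : ptB ∈ _))
    convert h using 1
    ext i
    fin_cases i <;> simp [midpoint_eq_smul_add, ptA, ptB, ptD]
    norm_num
  have h := hconv.lineMap_mem (subset_convexHull ℝ _ (by simp : ptC ∈ _)) hD (t := z / 4)
    ⟨by linarith, by linarith⟩
  convert h using 1
  ext i
  fin_cases i <;> simp [AffineMap.lineMap_apply_module, ptC, ptD]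

theorem axis_mem_triCDE {z : ℝ} (h0 : 0 ≤ z) (h4 : z ≤ 4) : (!₂[0, 0, z] : E3) ∈ triCDE := by
  have h := (convex_convexHull ℝ ({ptC, ptD, ptE} : Set E3)).lineMap_mem
    (subset_convexHull ℝ _ (by simp : ptC ∈ _)) (subset_convexHull ℝ _ (by simp : ptD ∈ _))
    (t := z / 4) ⟨by linarith, by linarith⟩
  convert h using 1
  ext i
  fin_cases i <;> simp [AffineMap.lineMap_apply_module, ptC, ptD]

/-- The distance between the projections of `x` and `y` to the tripod, the cross section of the
book. The three legs are two opposite half-lines on the first axis and one half-line on the second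
axis, so that the intrinsic distance of the tripod is the `ℓ¹` distance of the plane. -/
noncomputable def legDist (x y : E3) : ℝ := |x 0 - y 0| + |x 1 - y 1|

theorem legDist_nonneg (x y : E3) : 0 ≤ legDist x y := by unfold legDist; positivity

theorem legDist_comm (x y : E3) : legDist x y = legDist y x := by
  simp only [legDist, abs_sub_comm]

theorem legDist_triangle (x y z : E3) : legDist x z ≤ legDist x y + legDist y z := by
  simp only [legDist]
  linarith [abs_sub_le (x 0) (y 0) (z 0), abs_sub_le (x 1) (y 1) (z 1)]

/-- The distance of the product of the tripod with a line. -/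
noncomputable def bookDist (x y : E3) : ℝ := √(legDist x y ^ 2 + (x 2 - y 2) ^ 2)

theorem bookDist_nonneg (x y : E3) : 0 ≤ bookDist x y := Real.sqrt_nonneg _

theorem bookDist_sq (x y : E3) : bookDist x y ^ 2 = legDist x y ^ 2 + (x 2 - y 2) ^ 2 :=
  Real.sq_sqrt (by positivity)

theorem bookDist_comm (x y : E3) : bookDist x y = bookDist y x := by
  unfold bookDist
  rw [legDist_comm, sub_sq_comm]

theorem bookDist_triangle (x y z : E3) : bookDist x z ≤ bookDist x y + bookDist y z := by
  have h := norm_add_le ((legDist x y : ℂ) + (x 2 - y 2 : ℝ) * Complex.I)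
    ((legDist y z : ℂ) + (y 2 - z 2 : ℝ) * Complex.I)
  have e : ((legDist x y : ℂ) + (x 2 - y 2 : ℝ) * Complex.I)
      + ((legDist y z : ℂ) + (y 2 - z 2 : ℝ) * Complex.I)
      = ((legDist x y + legDist y z : ℝ) : ℂ) + (x 2 - z 2 : ℝ) * Complex.I := by
    push_cast
    ring
  rw [e, Complex.norm_add_mul_I, Complex.norm_add_mul_I, Complex.norm_add_mul_I] at h
  refine le_trans (Real.sqrt_le_sqrt ?_) h
  gcongr
  · exact legDist_nonneg x z
  · exact legDist_triangle x y z

theorem dist_eq_bookDist {x y : E3} (h : x 0 = y 0 ∨ x 1 = y 1) : dist x y = bookDist x y := by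
  rw [EuclideanSpace.dist_eq, bookDist, Fin.sum_univ_three, legDist]
  simp only [Real.dist_eq, sq_abs]
  rcases h with h | h <;> simp [h]

theorem dist_eq_bookDist_of_mem_triABC {x y : E3} (hx : x ∈ triABC) (hy : y ∈ triABC) :
    dist x y = bookDist x y :=
  dist_eq_bookDist (Or.inr ((coord_of_mem_triABC hx).1.trans (coord_of_mem_triABC hy).1.symm))

theorem dist_eq_bookDist_of_mem_triCDE {x y : E3} (hx : x ∈ triCDE) (hy : y ∈ triCDE) :
    dist x y = bookDist x y :=
  dist_eq_bookDist (Or.inl ((coord_of_mem_triCDE hx).1.trans (coord_of_mem_triCDE hy).1.symm))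

/-- A path from one triangle to the other meets the common edge, and each of the two parts is at
least as long as the flat distance of its ends. -/
theorem bookDist_le_pathLength_of_mem {x y : carrier} (hx : (x : E3) ∈ triABC)
    (hy : (y : E3) ∈ triCDE) (γ : Path x y) :
    ENNReal.ofReal (bookDist x y) ≤ pathLength γ := by
  obtain ⟨t, h1, h2⟩ :=
    Path.exists_mem_inter (S := carrier) subset_rfl isClosed_triABC isClosed_triCDE hx hy γ
  refine le_trans ?_ (edist_add_edist_le_pathLength γ t)
  rw [edist_dist, edist_dist, ← ENNReal.ofReal_add dist_nonneg dist_nonneg,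
    dist_eq_bookDist_of_mem_triABC hx h1, dist_eq_bookDist_of_mem_triCDE h2 hy]
  exact ENNReal.ofReal_le_ofReal (bookDist_triangle _ _ _)

theorem bookDist_le_pathLength {x y : carrier} (γ : Path x y) :
    ENNReal.ofReal (bookDist x y) ≤ pathLength γ := by
  rcases x.2 with hx | hx <;> rcases y.2 with hy | hy
  · rw [← dist_eq_bookDist_of_mem_triABC hx hy, ← edist_dist]
    exact edist_le_pathLength γ
  · exact bookDist_le_pathLength_of_mem hx hy γ
  · rw [bookDist_comm]
    exact (bookDist_le_pathLength_of_mem hy hx γ.symm).trans (pathLength_symm_le γ)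
  · rw [← dist_eq_bookDist_of_mem_triCDE hx hy, ← edist_dist]
    exact edist_le_pathLength γ

/-- When the two pages through `x` and `y` are unfolded into a plane, the segment from `x` to `y`
meets the common edge at the height obtained by weighting the heights of `x` and `y` with the
distances to that edge. -/
theorem exists_axis_bookDist_add {x y : E3} (hx : x ∈ triABC) (hy : y ∈ triCDE)
    (hr : 0 < |x 0|) (hs : 0 < y 1) :
    ∃ w : E3, w ∈ triABC ∧ w ∈ triCDE ∧ w 0 = 0 ∧ w 1 = 0 ∧
      (|x 0| + y 1) * w 2 = y 1 * x 2 + |x 0| * y 2 ∧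
      bookDist x w + bookDist w y = bookDist x y := by
  obtain ⟨hx1, hx2, hx3⟩ := coord_of_mem_triABC hx
  obtain ⟨hy0, hy1, hy2, hy3⟩ := coord_of_mem_triCDE hy
  set r := |x 0| with hrdef
  set s := y 1 with hsdef
  have hp : 0 < r + s := by positivity
  set z := (s * x 2 + r * y 2) / (r + s) with hz
  have h0 : 0 ≤ z := by positivity
  have h4 : z ≤ 4 := by
    rw [hz, div_le_iff₀ hp]
    nlinarith
  refine ⟨!₂[0, 0, z], axis_mem_triABC h0 h4, axis_mem_triCDE h0 h4, by simp, by simp,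
    by simp [hz]; field_simp, ?_⟩
  -- Both parts are similar copies of the whole, with factors `r / (r + s)` and `s / (r + s)`.
  have e0 : legDist x y = r + s := by
    simp [legDist, hy0, hx1, ← hrdef, ← hsdef, abs_of_pos hs]
  have e1 : bookDist x !₂[0, 0, z] = r / (r + s) * bookDist x y := by
    have : legDist x !₂[0, 0, z] = r := by simp [legDist, hx1, ← hrdef]
    have hn := bookDist_nonneg x y
    refine (pow_left_inj₀ (bookDist_nonneg _ _) (by positivity) two_ne_zero).1 ?_
    rw [mul_pow, bookDist_sq, bookDist_sq, this, e0]
    simp [hz]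
    field_simp
    ring
  have e2 : bookDist !₂[0, 0, z] y = s / (r + s) * bookDist x y := by
    have : legDist !₂[0, 0, z] y = s := by simp [legDist, hy0, ← hsdef, abs_of_pos hs]
    have hn := bookDist_nonneg x y
    refine (pow_left_inj₀ (bookDist_nonneg _ _) (by positivity) two_ne_zero).1 ?_
    rw [mul_pow, bookDist_sq, bookDist_sq, this, e0]
    simp [hz]
    field_simp
    ring
  rw [e1, e2]
  field_simp

theorem mem_triCDE_of_coord_eq_zero {x : E3} (hx : x ∈ triABC) (h : x 0 = 0) : x ∈ triCDE := by
  obtain ⟨h1, h2, h3⟩ := coord_of_mem_triABC hx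
  have e : x = !₂[0, 0, x 2] := by
    ext i
    fin_cases i <;> simp [h, h1]
  rw [e]
  exact axis_mem_triCDE h2 h3

theorem mem_triABC_of_coord_eq_zero {x : E3} (hx : x ∈ triCDE) (h : x 1 = 0) : x ∈ triABC := by
  obtain ⟨h1, -, h2, h3⟩ := coord_of_mem_triCDE hx
  have e : x = !₂[0, 0, x 2] := by
    ext i
    fin_cases i <;> simp [h, h1]
  rw [e]
  exact axis_mem_triABC h2 h3

theorem exists_path_triABC {x y : carrier} (hx : (x : E3) ∈ triABC) (hy : (y : E3) ∈ triABC) :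
    ∃ γ : Path x y, pathLength γ ≤ ENNReal.ofReal (bookDist x y) := by
  rw [← dist_eq_bookDist_of_mem_triABC hx hy, ← edist_dist]
  exact exists_path_of_convex (convex_convexHull ℝ _) Set.subset_union_left hx hy

theorem exists_path_triCDE {x y : carrier} (hx : (x : E3) ∈ triCDE) (hy : (y : E3) ∈ triCDE) :
    ∃ γ : Path x y, pathLength γ ≤ ENNReal.ofReal (bookDist x y) := by
  rw [← dist_eq_bookDist_of_mem_triCDE hx hy, ← edist_dist]
  exact exists_path_of_convex (convex_convexHull ℝ _) Set.subset_union_right hx hy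

theorem exists_path_of_mem {x y : carrier} (hx : (x : E3) ∈ triABC) (hy : (y : E3) ∈ triCDE) :
    ∃ γ : Path x y, pathLength γ ≤ ENNReal.ofReal (bookDist x y) := by
  rcases eq_or_ne ((x : E3) 0) 0 with h0 | h0
  · exact exists_path_triCDE (mem_triCDE_of_coord_eq_zero hx h0) hy
  rcases eq_or_ne ((y : E3) 1) 0 with h1 | h1
  · exact exists_path_triABC hx (mem_triABC_of_coord_eq_zero hy h1)
  obtain ⟨w, hw, hw', -, -, -, he⟩ := exists_axis_bookDist_add hx hy (abs_pos.2 h0)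
    (lt_of_le_of_ne (coord_of_mem_triCDE hy).2.1 h1.symm)
  obtain ⟨γ, hγ⟩ := exists_path_triABC (y := ⟨w, Or.inl hw⟩) hx hw
  obtain ⟨γ', hγ'⟩ := exists_path_triCDE (x := ⟨w, Or.inl hw⟩) hw' hy
  refine ⟨γ.trans γ', (pathLength_trans_le γ γ').trans ((add_le_add hγ hγ').trans ?_)⟩
  exact ((ENNReal.ofReal_add (bookDist_nonneg _ _) (bookDist_nonneg _ _)).symm.trans
    (congrArg _ he)).le

theorem exists_path_pathLength_eq (x y : carrier) :
    ∃ γ : Path x y, pathLength γ = ENNReal.ofReal (bookDist x y) := by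
  suffices h : ∃ γ : Path x y, pathLength γ ≤ ENNReal.ofReal (bookDist x y) by
    obtain ⟨γ, hγ⟩ := h
    exact ⟨γ, le_antisymm hγ (bookDist_le_pathLength γ)⟩
  rcases x.2 with hx | hx <;> rcases y.2 with hy | hy
  · exact exists_path_triABC hx hy
  · exact exists_path_of_mem hx hy
  · obtain ⟨γ, hγ⟩ := exists_path_of_mem hy hx
    exact ⟨γ.symm, (pathLength_symm_le γ).trans (by rwa [bookDist_comm])⟩
  · exact exists_path_triCDE hx hy

theorem dist_eq (x y : Space) : dist x y = bookDist x.pt y.pt := by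
  have h : edist x y = ENNReal.ofReal (bookDist x.pt y.pt) := by
    obtain ⟨γ, hγ⟩ := exists_path_pathLength_eq x.pt y.pt
    exact le_antisymm ((iInf_le _ γ).trans hγ.le) (le_iInf bookDist_le_pathLength)
  rw [edist_dist] at h
  exact (ENNReal.ofReal_eq_ofReal_iff dist_nonneg (bookDist_nonneg _ _)).1 h

/-! ### The CAT(0) inequality in the book -/

/-- The comparison for a point `p` of the tripod on a leg that the geodesic does not use: `q` is the
distance of `p` from the centre, and `u`, `v` are the coordinates of the ends on the line formed by
the other two legs. -/
theorem leg_sq_le {q u v t : ℝ} (hq : 0 ≤ q) (h0 : 0 ≤ t) (h1 : t ≤ 1) :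
    (q + |(1 - t) * u + t * v|) ^ 2
      ≤ (1 - t) * (q + |u|) ^ 2 + t * (q + |v|) ^ 2 - t * (1 - t) * (u - v) ^ 2 := by
  have h2 : |(1 - t) * u + t * v| ≤ (1 - t) * |u| + t * |v| := by
    refine (abs_add_le _ _).trans (le_of_eq ?_)
    rw [abs_mul, abs_mul, abs_of_nonneg h0, abs_of_nonneg (sub_nonneg.2 h1)]
  have h3 := mul_le_mul_of_nonneg_left h2 hq
  nlinarith [sq_abs u, sq_abs v, sq_abs ((1 - t) * u + t * v)]

theorem line_sq_eq (q u v t : ℝ) : (q - ((1 - t) * u + t * v)) ^ 2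
    = (1 - t) * (q - u) ^ 2 + t * (q - v) ^ 2 - t * (1 - t) * (u - v) ^ 2 := by
  ring

/-- The inequality of `HasCNPoints` for a single `p`, with the tripod in place of the book. -/
def LegIneq (t : ℝ) (x y m p : E3) : Prop :=
  legDist p m ^ 2 ≤ (1 - t) * legDist p x ^ 2 + t * legDist p y ^ 2 - t * (1 - t) * legDist x y ^ 2

/-- `m` is a point of the book that satisfies the inequality of `HasCNPoints` in the tripod; its
height is affine in `t`, which gives equality in the factor `ℝ`. -/
def IsCNPoint (t : ℝ) (x y m : E3) : Prop :=
  m ∈ carrier ∧ m 2 = (1 - t) * x 2 + t * y 2 ∧ ∀ p ∈ carrier, LegIneq t x y m p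

theorem IsCNPoint.symm {t : ℝ} {x y m : E3} (h : IsCNPoint t x y m) : IsCNPoint (1 - t) y x m := by
  refine ⟨h.1, h.2.1.trans (by ring), fun p hp => ?_⟩
  have := h.2.2 p hp
  unfold LegIneq at this ⊢
  rw [legDist_comm y x]
  linarith

theorem isCNPoint_triABC {t : ℝ} (h0 : 0 ≤ t) (h1 : t ≤ 1) {x y : E3} (hx : x ∈ triABC)
    (hy : y ∈ triABC) : IsCNPoint t x y (AffineMap.lineMap x y t) := by
  have hm : AffineMap.lineMap x y t ∈ triABC := (convex_convexHull ℝ _).lineMap_mem hx hy ⟨h0, h1⟩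
  refine ⟨Or.inl hm, by simp [AffineMap.lineMap_apply_module], fun p hp => ?_⟩
  have em : (AffineMap.lineMap x y t : E3) 0 = (1 - t) * x 0 + t * y 0 := by
    simp [AffineMap.lineMap_apply_module]
  simp only [LegIneq, legDist, (coord_of_mem_triABC hx).1, (coord_of_mem_triABC hy).1,
    (coord_of_mem_triABC hm).1, em]
  rcases hp with hp | hp
  · simp only [(coord_of_mem_triABC hp).1, sub_self, abs_zero, add_zero, sq_abs]
    exact (line_sq_eq _ _ _ _).le
  · have h := leg_sq_le (coord_of_mem_triCDE hp).2.1 h0 h1 (u := x 0) (v := y 0)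
    simp only [(coord_of_mem_triCDE hp).1, zero_sub, abs_neg, sub_zero, abs_zero, add_zero, sq_abs,
      abs_of_nonneg (coord_of_mem_triCDE hp).2.1]
    linarith

theorem isCNPoint_triCDE {t : ℝ} (h0 : 0 ≤ t) (h1 : t ≤ 1) {x y : E3} (hx : x ∈ triCDE)
    (hy : y ∈ triCDE) : IsCNPoint t x y (AffineMap.lineMap x y t) := by
  have hm : AffineMap.lineMap x y t ∈ triCDE := (convex_convexHull ℝ _).lineMap_mem hx hy ⟨h0, h1⟩
  refine ⟨Or.inr hm, by simp [AffineMap.lineMap_apply_module], fun p hp => ?_⟩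
  have em : (AffineMap.lineMap x y t : E3) 1 = (1 - t) * x 1 + t * y 1 := by
    simp [AffineMap.lineMap_apply_module]
  simp only [LegIneq, legDist, (coord_of_mem_triCDE hx).1, (coord_of_mem_triCDE hy).1,
    (coord_of_mem_triCDE hm).1, em]
  rcases hp with hp | hp
  · have h := leg_sq_le (abs_nonneg (p 0)) h0 h1 (u := x 1) (v := y 1)
    simpa only [(coord_of_mem_triABC hp).1, zero_sub, abs_neg, sub_zero, sub_self, abs_zero,
      zero_add, sq_abs] using h
  · simp only [(coord_of_mem_triCDE hp).1, sub_self, abs_zero, zero_add, sq_abs]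
    exact (line_sq_eq _ _ _ _).le

/-- The point at parameter `t` of the broken line from `x` to `y`; `u` is its coordinate on the line
formed by the legs of `x` and `y`, on which `x` has a negative coordinate. -/
theorem exists_mem_broken_line {t : ℝ} (h0 : 0 ≤ t) (h1 : t ≤ 1) {x y : E3} (hx : x ∈ triABC)
    (hy : y ∈ triCDE) (hr : 0 < |x 0|) (hs : 0 < y 1) {u : ℝ}
    (hu : u = (1 - t) * (-|x 0|) + t * y 1) :
    ∃ m ∈ carrier, m 2 = (1 - t) * x 2 + t * y 2 ∧
      ((m 1 = 0 ∧ ∃ k, 0 ≤ k ∧ m 0 = k * x 0 ∧ k * |x 0| = -u) ∨ (0 ≤ u ∧ m 0 = 0 ∧ m 1 = u)) := by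
  obtain ⟨w, hw, hw', w0, w1, w2, -⟩ := exists_axis_bookDist_add hx hy hr hs
  have hx1 := (coord_of_mem_triABC hx).1
  have hy0 := (coord_of_mem_triCDE hy).1
  set r := |x 0| with hrdef
  set s := y 1 with hsdef
  have hp : 0 < r + s := by positivity
  have hw2 : w 2 = (s * x 2 + r * y 2) / (r + s) := by
    rw [eq_div_iff hp.ne', ← w2, mul_comm]
  rcases le_total u 0 with hu0 | hu0
  · have hk0 : 0 ≤ -u / r := by apply div_nonneg <;> linarith
    have hk1 : -u / r ≤ 1 := by
      rw [div_le_one hr, hu]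
      nlinarith
    refine ⟨AffineMap.lineMap w x (-u / r), Or.inl ((convex_convexHull ℝ _).lineMap_mem hw hx
      ⟨hk0, hk1⟩), ?_, Or.inl ⟨?_, -u / r, hk0, ?_, div_mul_cancel₀ _ hr.ne'⟩⟩
    · simp only [AffineMap.lineMap_apply_module, PiLp.add_apply, PiLp.smul_apply, smul_eq_mul,
        hw2, hu]
      field_simp
      ring
    · simp [AffineMap.lineMap_apply_module, hx1, w1]
    · simp [AffineMap.lineMap_apply_module, w0]
  · have hk0 : 0 ≤ u / s := by positivity
    have hk1 : u / s ≤ 1 := by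
      rw [div_le_one hs, hu]
      nlinarith
    refine ⟨AffineMap.lineMap w y (u / s), Or.inr ((convex_convexHull ℝ _).lineMap_mem hw' hy
      ⟨hk0, hk1⟩), ?_, Or.inr ⟨hu0, ?_, ?_⟩⟩
    · simp only [AffineMap.lineMap_apply_module, PiLp.add_apply, PiLp.smul_apply, smul_eq_mul,
        hw2, hu]
      field_simp
      ring
    · simp [AffineMap.lineMap_apply_module, hy0, w0]
    · simp [AffineMap.lineMap_apply_module, w1, ← hsdef, hs.ne']

theorem abs_sub_of_mul_nonneg {a b : ℝ} (h : 0 ≤ a * b) : |a - b| = |(|a| - |b|)| := by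
  rcases mul_nonneg_iff.1 h with ⟨ha, hb⟩ | ⟨ha, hb⟩
  · rw [abs_of_nonneg ha, abs_of_nonneg hb]
  · rw [abs_of_nonpos ha, abs_of_nonpos hb, ← abs_neg]
    congr 1
    ring

theorem abs_sub_of_mul_nonpos {a b : ℝ} (h : a * b ≤ 0) : |a - b| = |a| + |b| := by
  rcases mul_nonpos_iff.1 h with ⟨ha, hb⟩ | ⟨ha, hb⟩
  · rw [abs_of_nonneg ha, abs_of_nonpos hb, abs_of_nonneg (by linarith)]
    ring
  · rw [abs_of_nonpos ha, abs_of_nonneg hb, abs_of_nonpos (by linarith)]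
    ring

theorem exists_isCNPoint_of_mem {t : ℝ} (h0 : 0 ≤ t) (h1 : t ≤ 1) {x y : E3} (hx : x ∈ triABC)
    (hy : y ∈ triCDE) : ∃ m, IsCNPoint t x y m := by
  rcases eq_or_ne (x 0) 0 with hx0 | hx0
  · exact ⟨_, isCNPoint_triCDE h0 h1 (mem_triCDE_of_coord_eq_zero hx hx0) hy⟩
  rcases eq_or_ne (y 1) 0 with hy1 | hy1
  · exact ⟨_, isCNPoint_triABC h0 h1 hx (mem_triABC_of_coord_eq_zero hy hy1)⟩
  obtain ⟨y0, hs', -, -⟩ := coord_of_mem_triCDE hy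
  have hs : 0 < y 1 := lt_of_le_of_ne hs' hy1.symm
  have x1 := (coord_of_mem_triABC hx).1
  obtain ⟨m, hm, m2, hm'⟩ := exists_mem_broken_line h0 h1 hx hy (abs_pos.2 hx0) hs rfl
  set u := (1 - t) * (-|x 0|) + t * y 1 with hu
  refine ⟨m, hm, m2, fun p hp => ?_⟩
  have exy : legDist x y = |x 0| + y 1 := by simp [legDist, x1, y0, abs_of_pos hs]
  have r0 := abs_nonneg (x 0)
  have q0 := abs_nonneg (p 0)
  -- If `p` lies on the line formed by the legs of `x` and `y`, with coordinate `q`, equality holds.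
  have on_line : ∀ q : ℝ, legDist p m = |q - u| → legDist p x = |q - (-|x 0|)| →
      legDist p y = |q - y 1| → LegIneq t x y m p := by
    intro q e1 e2 e3
    rw [LegIneq, e1, e2, e3, exy, sq_abs, sq_abs, sq_abs, hu, line_sq_eq]
    linarith
  rcases hp with hp | hp
  · have p1 := (coord_of_mem_triABC hp).1
    have epy : legDist p y = |p 0| + y 1 := by simp [legDist, p1, y0, abs_of_pos hs]
    rcases le_total 0 (p 0 * x 0) with hpx | hpx
    · refine on_line (-|p 0|) ?_ ?_ ?_
      · rcases hm' with ⟨m1, k, hk, m0, hku⟩ | ⟨hu0, m0, m1⟩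
        · have : 0 ≤ p 0 * (k * x 0) := by
            rw [mul_left_comm]
            positivity
          rw [legDist, m0, m1, p1, abs_sub_of_mul_nonneg this, abs_mul, abs_of_nonneg hk, hku,
            sub_self, abs_zero, add_zero, ← abs_neg]
          congr 1
          ring
        · rw [legDist, m0, m1, p1, sub_zero, zero_sub, abs_neg, abs_of_nonneg hu0,
            abs_of_nonpos (a := -|p 0| - u) (by linarith)]
          ring
      · rw [legDist, x1, p1, abs_sub_of_mul_nonneg hpx, sub_self, abs_zero, add_zero, ← abs_neg]
        congr 1
        ring
      · rw [epy, abs_of_nonpos (a := -|p 0| - y 1) (by linarith)]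
        ring
    · have epx : legDist p x = |p 0| + |(-|x 0|)| := by
        rw [legDist, x1, p1, abs_sub_of_mul_nonpos hpx, sub_self, abs_zero, add_zero, abs_neg,
          abs_abs]
      have epm : legDist p m = |p 0| + |u| := by
        rcases hm' with ⟨m1, k, hk, m0, hku⟩ | ⟨hu0, m0, m1⟩
        · have : p 0 * (k * x 0) ≤ 0 := by
            rw [mul_left_comm]
            exact mul_nonpos_of_nonneg_of_nonpos hk hpx
          have hu' : |u| = -u := abs_of_nonpos (by nlinarith)
          rw [legDist, m0, m1, p1, abs_sub_of_mul_nonpos this, abs_mul, abs_of_nonneg hk, hku,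
            sub_self, abs_zero, add_zero, hu']
        · rw [legDist, m0, m1, p1, sub_zero, zero_sub, abs_neg]
      have h := leg_sq_le q0 h0 h1 (u := -|x 0|) (v := y 1)
      rw [abs_of_pos hs] at h
      rw [LegIneq, epm, epx, epy, exy, hu]
      linarith
  · obtain ⟨p0, p1, -, -⟩ := coord_of_mem_triCDE hp
    refine on_line (p 1) ?_ ?_ ?_
    · rcases hm' with ⟨m1, k, hk, m0, hku⟩ | ⟨hu0, m0, m1⟩
      · rw [legDist, m0, m1, p0, zero_sub, abs_neg, abs_mul, abs_of_nonneg hk, hku, sub_zero,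
          abs_of_nonneg p1, abs_of_nonneg (by nlinarith)]
        ring
      · rw [legDist, m0, m1, p0, sub_self, abs_zero, zero_add]
    · rw [legDist, x1, p0, zero_sub, abs_neg, sub_zero, abs_of_nonneg p1,
        abs_of_nonneg (a := p 1 - (-|x 0|)) (by linarith)]
      ring
    · rw [legDist, p0, y0, sub_self, abs_zero, zero_add]

theorem hasCNPoints : HasCNPoints Space := by
  intro x y t ht
  obtain ⟨m, hm, m2, h⟩ : ∃ m, IsCNPoint t x.pt y.pt m := by
    rcases x.pt.2 with hx | hx <;> rcases y.pt.2 with hy | hy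
    · exact ⟨_, isCNPoint_triABC ht.1 ht.2 hx hy⟩
    · exact exists_isCNPoint_of_mem ht.1 ht.2 hx hy
    · obtain ⟨m, hm⟩ := exists_isCNPoint_of_mem (t := 1 - t) (by linarith [ht.2])
        (by linarith [ht.1]) hy hx
      exact ⟨m, by simpa using hm.symm⟩
    · exact ⟨_, isCNPoint_triCDE ht.1 ht.2 hx hy⟩
  refine ⟨⟨⟨m, hm⟩⟩, fun p => ?_⟩
  have hl := h _ p.pt.2
  unfold LegIneq at hl
  have hz := line_sq_eq ((p.pt : E3) 2) ((x.pt : E3) 2) ((y.pt : E3) 2) t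
  rw [← m2] at hz
  simp only [dist_eq, bookDist_sq]
  linarith

/-! ### The segment from `C` to `E` and projections onto it -/

/-- The point `t E` of the segment `[C, E]`. -/
noncomputable def segPt (t : ℝ) (ht : t ∈ Set.Icc (0 : ℝ) 1) : Space :=
  ⟨AffineMap.lineMap ptC ptE t, Or.inr ((convex_convexHull ℝ _).lineMap_mem
    (subset_convexHull ℝ _ (by simp)) (subset_convexHull ℝ _ (by simp)) ht)⟩

theorem segPt_coord (t : ℝ) (ht : t ∈ Set.Icc (0 : ℝ) 1) :
    ((segPt t ht).pt : E3) 0 = 0 ∧ ((segPt t ht).pt : E3) 1 = t * (3 * √7 / 8) ∧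
      ((segPt t ht).pt : E3) 2 = t * (1 / 8) := by
  simp [segPt, AffineMap.lineMap_apply_module, ptC, ptE]

theorem segPt_dist (t : ℝ) (ht : t ∈ Set.Icc (0 : ℝ) 1) :
    dist C (segPt t ht) = t * dist C E ∧ dist (segPt t ht) E = (1 - t) * dist C E := by
  have e : (segPt t ht).pt = AffineMap.lineMap ptC ptE t := rfl
  have h : ∀ x y : E3, x 0 = 0 → y 0 = 0 → bookDist x y = dist x y := fun x y hx hy =>
    (dist_eq_bookDist (Or.inl (hx.trans hy.symm))).symm
  have hC : (C.pt : E3) 0 = 0 := by simp [C, ptC]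
  have hE : (E.pt : E3) 0 = 0 := by simp [E, ptE]
  have hS := (segPt_coord t ht).1
  rw [dist_eq, dist_eq, dist_eq, h _ _ hC hS, h _ _ hS hE, h _ _ hC hE]
  change dist ptC (AffineMap.lineMap ptC ptE t) = t * dist ptC ptE ∧
    dist (AffineMap.lineMap ptC ptE t) ptE = (1 - t) * dist ptC ptE
  rw [dist_left_lineMap, dist_lineMap_right, Real.norm_eq_abs, Real.norm_eq_abs,
    abs_of_nonneg ht.1, abs_of_nonneg (sub_nonneg.2 ht.2)]
  exact ⟨rfl, rfl⟩

theorem mem_segment_iff {s : Set Space} (hs : IsMetricSegment C E s) (z : Space) :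
    z ∈ s ↔ ∃ t ht, z = segPt t ht := by
  constructor
  · intro hz
    obtain ⟨t, ht, h1, h2⟩ := hs.exists_dist_eq_mul hz
    exact ⟨t, ht, hasCNPoints.eq_of_dist_eq ht h1 h2 (segPt_dist t ht).1 (segPt_dist t ht).2⟩
  · rintro ⟨t, ht, rfl⟩
    rw [hasCNPoints.eq_setOf_dist_add_dist hs]
    change _ + _ = _
    rw [(segPt_dist t ht).1, (segPt_dist t ht).2]
    ring

theorem segPt_zero : segPt 0 ⟨le_rfl, zero_le_one⟩ = C := by
  simp [segPt, C]

theorem segPt_half : segPt (1 / 2) ⟨by norm_num, by norm_num⟩ = F := by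
  refine InducedLength.ext (Subtype.ext ?_)
  ext i
  fin_cases i <;> simp [segPt, F, AffineMap.lineMap_apply_module, ptC, ptE] <;> ring

theorem dist_sq_D_segPt (t : ℝ) (ht : t ∈ Set.Icc (0 : ℝ) 1) :
    dist D (segPt t ht) ^ 2 = t ^ 2 - t + 16 := by
  obtain ⟨h0, h1, h2⟩ := segPt_coord t ht
  have h7 : √7 ^ 2 = (7 : ℝ) := Real.sq_sqrt (by norm_num)
  rw [dist_eq, bookDist_sq, legDist, h0, h1, h2]
  simp only [D, ptD, PiLp.toLp_apply, Matrix.cons_val, sub_self, abs_zero, zero_add, sq_abs]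
  linear_combination (9 / 64) * t ^ 2 * h7

/-- In the unfolded plane the angle at `C` between `x` and `E` is obtuse: the linear coefficient
is positive. -/
theorem dist_sq_segPt {x : Space} (hx0 : |(x.pt : E3) 0| = 1) (hx1 : (x.pt : E3) 1 = 0)
    (hx2 : (x.pt : E3) 2 = 4) (t : ℝ) (ht : t ∈ Set.Icc (0 : ℝ) 1) :
    dist x (segPt t ht) ^ 2 = t ^ 2 + t * (3 * √7 / 4 - 1) + 17 := by
  obtain ⟨h0, h1, h2⟩ := segPt_coord t ht
  have h7 : √7 ^ 2 = (7 : ℝ) := Real.sq_sqrt (by norm_num)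
  have hp : 0 ≤ t * (3 * √7 / 8) := mul_nonneg ht.1 (by positivity)
  rw [dist_eq, bookDist_sq, legDist, h0, h1, h2, hx1, hx2, sub_zero, hx0, zero_sub, abs_neg,
    abs_of_nonneg hp]
  linear_combination (9 / 64) * t ^ 2 * h7

theorem metricProj_D {s : Set Space} (hs : IsMetricSegment C E s) : metricProj s D = {F} := by
  apply metricProj_eq_singleton ((mem_segment_iff hs F).2 ⟨_, _, segPt_half.symm⟩)
  intro q hq hqF
  obtain ⟨t, ht, rfl⟩ := (mem_segment_iff hs q).1 hq
  have ht' : t - 1 / 2 ≠ 0 := fun h => hqF (by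
    obtain rfl : t = 1 / 2 := by linarith
    exact segPt_half)
  have h1 := dist_sq_D_segPt t ht
  have h2 := dist_sq_D_segPt (1 / 2) ⟨by norm_num, by norm_num⟩
  rw [segPt_half] at h2
  have h3 : 0 < (t - 1 / 2) ^ 2 := by positivity
  exact (sq_lt_sq₀ dist_nonneg dist_nonneg).1 (by linarith)

theorem metricProj_eq_C {s : Set Space} (hs : IsMetricSegment C E s) {x : Space}
    (hx0 : |(x.pt : E3) 0| = 1) (hx1 : (x.pt : E3) 1 = 0) (hx2 : (x.pt : E3) 2 = 4) :
    metricProj s x = {C} := by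
  apply metricProj_eq_singleton ((mem_segment_iff hs C).2 ⟨_, _, segPt_zero.symm⟩)
  intro q hq hqC
  obtain ⟨t, ht, rfl⟩ := (mem_segment_iff hs q).1 hq
  have ht' : t ≠ 0 := fun h => hqC (by
    subst h
    exact segPt_zero)
  have htp : 0 < t := lt_of_le_of_ne ht.1 ht'.symm
  have h1 := dist_sq_segPt hx0 hx1 hx2 t ht
  have h2 := dist_sq_segPt hx0 hx1 hx2 0 ⟨le_rfl, zero_le_one⟩
  rw [segPt_zero] at h2
  have h7 : 2 < √7 := Real.lt_sqrt_of_sq_lt (by norm_num)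
  have h3 : 0 < t * (3 * √7 / 4 - 1) := mul_pos htp (by linarith)
  have h4 : 0 < t ^ 2 := by positivity
  exact (sq_lt_sq₀ dist_nonneg dist_nonneg).1 (by linarith)

theorem metricProj_A {s : Set Space} (hs : IsMetricSegment C E s) : metricProj s A = {C} :=
  metricProj_eq_C hs (by simp [A, ptA]) (by simp [A, ptA]) (by simp [A, ptA])

theorem metricProj_B {s : Set Space} (hs : IsMetricSegment C E s) : metricProj s B = {C} :=
  metricProj_eq_C hs (by simp [B, ptB]) (by simp [B, ptB]) (by simp [B, ptB])

theorem C_ne_F : C ≠ F := by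
  intro h
  have : (C.pt : E3) 2 = (F.pt : E3) 2 := by rw [h]
  simp [C, F, ptC] at this

theorem isGeodesicCombo_half_iff (m : Space) : IsGeodesicCombo (1 / 2) A B m ↔ m = D := by
  have hAB : dist A B = 2 := by
    simp [dist_eq, bookDist, legDist, A, B, ptA, ptB]
    norm_num
  have hAD : dist A D = 1 := by simp [dist_eq, bookDist, legDist, A, D, ptA, ptD]
  have hDB : dist D B = 1 := by simp [dist_eq, bookDist, legDist, B, D, ptB, ptD]
  constructor
  · rintro ⟨s, -, -, h1, h2⟩
    exact hasCNPoints.eq_of_dist_eq (x := A) (y := B) (t := 1 / 2) ⟨by norm_num, by norm_num⟩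
      (by linarith) (by linarith) (by linarith) (by linarith)
  · rintro rfl
    obtain ⟨s, hs⟩ := hasCNPoints.exists_isMetricSegment A B
    refine ⟨s, hs, ?_, by linarith, by linarith⟩
    rw [hasCNPoints.eq_setOf_dist_add_dist hs]
    change _ + _ = _
    linarith

theorem not_hasPropertyN : ¬ HasPropertyN Space := by
  intro h
  obtain ⟨s, hs⟩ := hasCNPoints.exists_isMetricSegment C E
  have h1 := h s hs.isClosed (hasCNPoints.isGeodesicallyConvex hs) A B C (metricProj_A hs)
    (metricProj_B hs) (1 / 2) ⟨by norm_num, by norm_num⟩ D ((isGeodesicCombo_half_iff D).2 rfl)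
  rw [metricProj_D hs] at h1
  exact C_ne_F (Set.singleton_injective h1).symm

end TwoTriangles

theorem mainTheorem5 :
    -- distances are the lengths of shortest paths
    (∀ x y : TwoTriangles.Space, ∃ γ : Path x.pt y.pt,
      pathLength γ = ENNReal.ofReal (dist x y) ∧
        ∀ γ' : Path x.pt y.pt, pathLength γ ≤ pathLength γ') ∧
    IsCAT0 TwoTriangles.Space ∧
    ¬ HasPropertyN TwoTriangles.Space ∧
    -- `D` is the midpoint of `A` and `B`
    (∀ m : TwoTriangles.Space,
      IsGeodesicCombo (1 / 2) TwoTriangles.A TwoTriangles.B m ↔ m = TwoTriangles.D) ∧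
    -- the metric segment `[C, E]` exists and is unique, and so are the projections onto it
    (∃! s : Set TwoTriangles.Space, IsMetricSegment TwoTriangles.C TwoTriangles.E s) ∧
    (∀ s : Set TwoTriangles.Space, IsMetricSegment TwoTriangles.C TwoTriangles.E s →
      metricProj s TwoTriangles.D = {TwoTriangles.F} ∧
      ∃ pA pB : TwoTriangles.Space,
        metricProj s TwoTriangles.A = {pA} ∧ metricProj s TwoTriangles.B = {pB} ∧
        pA = pB ∧ pA ≠ TwoTriangles.F ∧
        ∀ t : Set TwoTriangles.Space, IsMetricSegment pA pB t → TwoTriangles.F ∉ t) := by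
  have hCN := TwoTriangles.hasCNPoints
  refine ⟨fun x y => ?_, hCN.isCAT0, TwoTriangles.not_hasPropertyN,
    TwoTriangles.isGeodesicCombo_half_iff, ?_, fun s hs => ⟨TwoTriangles.metricProj_D hs,
      TwoTriangles.C, TwoTriangles.C, TwoTriangles.metricProj_A hs, TwoTriangles.metricProj_B hs,
      rfl, TwoTriangles.C_ne_F, fun t ht hF => ?_⟩⟩
  · obtain ⟨γ, hγ⟩ := TwoTriangles.exists_path_pathLength_eq x.pt y.pt
    refine ⟨γ, by rw [hγ, TwoTriangles.dist_eq], fun γ' => ?_⟩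
    rw [hγ]
    exact TwoTriangles.bookDist_le_pathLength γ'
  · obtain ⟨s, hs⟩ := hCN.exists_isMetricSegment TwoTriangles.C TwoTriangles.E
    exact ⟨s, hs, fun s' hs' =>
      (hCN.eq_setOf_dist_add_dist hs').trans (hCN.eq_setOf_dist_add_dist hs).symm⟩
  · have h := ht.dist_add_dist hF
    rw [dist_self, dist_comm TwoTriangles.F] at h
    exact TwoTriangles.C_ne_F (dist_eq_zero.1 (by linarith))
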